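/- Let $\mathbb F_q$ be a finite field with $q$ elements and $G$ a finite group with $\gcd(|G|,q)=1$. Write $G^{ab}\cong\mathbb Z/n_1\mathbb Z\oplus\dots\oplus\mathbb Z/n_r\mathbb Z$ with $1<n_1\mid n_2\mid\cdots\mid n_r$, where $G^{ab}$ is the abelianization of $G$, $r\ge 0$, and $n_j$ is read as $1$ for $j\le 0$. A group code in $\mathbb F_q[G]$ is a two-sided ideal $C$ of the group algebra; its hull is $h(C)=C\cap C^{\perp}$, where $C^\perp$ is the dual of $C$ with respect to the Euclidean inner product $\langle\sum_g a_g g,\sum_g b_g g\rangle=\sum_g a_gb_g$. Then there exists a group code $C$ in $\mathbb F_q[G]$ with $\dim_{\mathbb F_q}h(C)=2$ if and only if at least one of the following conditions is satisfied: 1. $\gcd(n_r,q-1)\ge 5$; 2. $3\le\gcd(n_r,q-1)\le 4$ and $\gcd(n_{r-1},q-1)\ge 2$; 3. $\gcd(n_r,q^2-1)>\gcd(n_r,q-1)$ and $\gcd(n_r,q^2-1)>\gcd(n_r,q+1)$. -/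

import Mathlib

namespace GroupCode

variable {F G : Type*} [Field F] [Group G] [Fintype G]

/-- The Euclidean inner product on the group algebra `F[G]`, for which the group elements form an
orthonormal basis: `⟨∑ a(g) g, ∑ b(g) g⟩ = ∑ a(g) b(g)`. -/
noncomputable def euclid (x y : MonoidAlgebra F G) : F := ∑ g : G, x.coeff g * y.coeff g

/-- The dual `C^⊥` of a linear code `C` in `F[G]` with respect to the Euclidean inner product. -/
noncomputable def dual (C : Submodule F (MonoidAlgebra F G)) : Submodule F (MonoidAlgebra F G) where
  carrier := {y | ∀ x ∈ C, euclid x y = 0}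
  zero_mem' := fun x _ => by simp [euclid]
  add_mem' := fun {a b} ha hb x hx => by
    have h1 := ha x hx
    have h2 := hb x hx
    simp only [euclid] at h1 h2 ⊢
    simp [mul_add, Finset.sum_add_distrib, h1, h2]
  smul_mem' := fun c a ha x hx => by
    have h1 := ha x hx
    simp only [euclid] at h1 ⊢
    simp [mul_left_comm _ c, ← Finset.mul_sum, h1]

/-- The hull `C ∩ C^⊥` of a linear code `C` in `F[G]`. -/
noncomputable def hull (C : Submodule F (MonoidAlgebra F G)) : Submodule F (MonoidAlgebra F G) :=
  C ⊓ dual C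

/-- For a finite sequence `n_1, …, n_r` (indexed by `Fin r`), `fromLast n j` is the entry
`n_{r-j}`, so `fromLast n 0 = n_r` and `fromLast n 1 = n_{r-1}`; entries that do not exist
(`r ≤ j`) are read as `1`, the order of a trivial cyclic summand. -/
def fromLast {r : ℕ} (n : Fin r → ℕ) (j : ℕ) : ℕ :=
  if h : j < r then n (Fin.rev ⟨j, h⟩) else 1

end GroupCode

/-! Since $|G|$ is prime to $q$, $\mathbb F_q[G]$ is semisimple, so a hull of dimension 2 is a
two-sided ideal generated by a central idempotent $x$, and acts as a quotient algebra of dimension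
2. Such an algebra is commutative and reduced: it is either a quadratic field or split by two
distinct characters into $\mathbb F_q$. The idempotent lies in both $C$ and $C^\perp$, and
orthogonality becomes $\varphi(x)\,\overline\varphi(x)=0$, where $\overline\varphi$ is $\varphi$
after $g\mapsto g^{-1}$ (`mul_conjHom_eq_zero`). Hence no character in the hull has its inverse in
the hull.

Conversely, a set of characters containing no inverse of its members spans a self-orthogonal ideal,
by orthogonality of characters (`exists_code_of_map`).

What remains is to decide when such sets exist. Two characters over $\mathbb F_q$ need
$\chi,\chi^{-1},\psi,\psi^{-1}$ distinct, which gives conditions 1 and 2. One Frobenius orbit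
$\{\chi,\chi^q\}$ over $\mathbb F_{q^2}$ needs $\chi^{q-1}\ne1$ and $\chi^{q+1}\ne1$, which gives
condition 3. -/

namespace GroupCode

/-! ### Characters of $G$ through the invariant factors of $G^{ab}$ -/

section Characters

variable {G M : Type*} [Group G] [CommGroup M] {r : ℕ} {n : Fin r → ℕ}

/-- The homomorphism `∏ ZMod (n i) → M` induced by a homomorphism `G → M` into a commutative
group. -/
noncomputable def coordHom (e : Additive (Abelianization G) ≃+ (∀ i, ZMod (n i))) (ψ : G →* M) :
    (∀ i, ZMod (n i)) →+ Additive M :=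
  (MonoidHom.toAdditive (Abelianization.lift ψ)).comp e.symm.toAddMonoidHom

theorem coordHom_apply (e : Additive (Abelianization G) ≃+ (∀ i, ZMod (n i))) (ψ : G →* M)
    (g : G) : coordHom e ψ (e (Additive.ofMul (Abelianization.of g))) = Additive.ofMul (ψ g) := by
  simp [coordHom]

/-- An element of `G` whose class in the abelianization is the `i`-th standard generator. -/
theorem exists_generator (e : Additive (Abelianization G) ≃+ (∀ i, ZMod (n i))) (i : Fin r) :
    ∃ g : G, e (Additive.ofMul (Abelianization.of g)) = Pi.single i 1 := by
  obtain ⟨g, hg⟩ := QuotientGroup.mk_surjective (e.symm (Pi.single i 1)).toMul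
  refine ⟨g, ?_⟩
  have : Additive.ofMul (Abelianization.of g) = e.symm (Pi.single i 1) :=
    congrArg Additive.ofMul hg
  rw [this, AddEquiv.apply_symm_apply]

theorem eq_one_of_generators (e : Additive (Abelianization G) ≃+ (∀ i, ZMod (n i))) (ψ : G →* M)
    (h : ∀ i g, e (Additive.ofMul (Abelianization.of g)) = Pi.single i 1 → ψ g = 1) : ψ = 1 := by
  have key : coordHom e ψ = 0 := by
    refine AddMonoidHom.functions_ext _ _ _ fun i x => ?_
    have : ((coordHom e ψ).comp (AddMonoidHom.single _ i)) 1 = 0 := by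
      obtain ⟨g, hg⟩ := exists_generator e i
      have h1 := coordHom_apply e ψ g
      rw [hg, h i g hg] at h1
      simpa using h1
    obtain ⟨z, rfl⟩ := ZMod.intCast_surjective x
    change ((coordHom e ψ).comp (AddMonoidHom.single _ i)) _ = 0
    rw [← zsmul_one z, map_zsmul, this, zsmul_zero]
  ext g
  have h1 := coordHom_apply e ψ g
  rw [key] at h1
  simpa using h1.symm

theorem apply_pow_eq_one (e : Additive (Abelianization G) ≃+ (∀ i, ZMod (n i))) (ψ : G →* M)
    {m : ℕ} (hm : ∀ i, n i ∣ m) (g : G) : ψ g ^ m = 1 := by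
  have h1 := coordHom_apply e ψ g
  have h2 : m • e (Additive.ofMul (Abelianization.of g)) = 0 := by
    ext i
    rw [Pi.smul_apply, nsmul_eq_mul, (ZMod.natCast_eq_zero_iff _ _).2 (hm i)]
    simp
  have h3 : m • Additive.ofMul (ψ g) = 0 := by rw [← h1, ← map_nsmul, h2, map_zero]
  exact h3

theorem apply_pow_eq_one_of_generator (e : Additive (Abelianization G) ≃+ (∀ i, ZMod (n i)))
    (ψ : G →* M) (i : Fin r) {g : G}
    (hg : e (Additive.ofMul (Abelianization.of g)) = Pi.single i 1) : ψ g ^ n i = 1 := by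
  have h1 := coordHom_apply e ψ g
  have h2 : n i • e (Additive.ofMul (Abelianization.of g)) = 0 := by
    rw [hg, ← Pi.single_smul]
    simp
  have h3 : n i • Additive.ofMul (ψ g) = 0 := by rw [← h1, ← map_nsmul, h2, map_zero]
  exact h3

/-- The character sending the `i`-th generator to `ζ` and the other generators to `1`. -/
theorem exists_character (e : Additive (Abelianization G) ≃+ (∀ i, ZMod (n i))) (i : Fin r)
    (ζ : M) (hζ : ζ ^ n i = 1) :
    ∃ ψ : G →* M, (∀ g, e (Additive.ofMul (Abelianization.of g)) = Pi.single i 1 → ψ g = ζ) ∧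
      ∀ j, j ≠ i → ∀ g, e (Additive.ofMul (Abelianization.of g)) = Pi.single j 1 → ψ g = 1 := by
  have hf : (zmultiplesHom (Additive M) (Additive.ofMul ζ)) (n i : ℤ) = 0 := by
    rw [zmultiplesHom_apply, natCast_zsmul]
    exact hζ
  let f : ZMod (n i) →+ Additive M := ZMod.lift (n i) ⟨zmultiplesHom _ (Additive.ofMul ζ), hf⟩
  have f1 : f 1 = Additive.ofMul ζ := by
    have := ZMod.lift_coe (n i) ⟨zmultiplesHom _ (Additive.ofMul ζ), hf⟩ 1
    simpa using this
  let Φ : Additive (Abelianization G) →+ Additive M :=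
    f.comp ((Pi.evalAddMonoidHom (fun i => ZMod (n i)) i).comp e.toAddMonoidHom)
  let ψ : G →* M := (MonoidHom.toAdditive.symm Φ).comp Abelianization.of
  have hψ : ∀ g, ψ g = (f (e (Additive.ofMul (Abelianization.of g)) i)).toMul := fun g => rfl
  refine ⟨ψ, fun g hg => ?_, fun j hj g hg => ?_⟩
  · rw [hψ, hg, Pi.single_eq_same, f1]; rfl
  · rw [hψ, hg, Pi.single_eq_of_ne (Ne.symm hj), map_zero]; rfl

theorem dvd_fromLast_zero (hdvd : ∀ i j, i ≤ j → n i ∣ n j) (i : Fin r) : n i ∣ fromLast n 0 := by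
  have hr : 0 < r := i.pos
  rw [fromLast, dif_pos hr]
  apply hdvd
  rw [Fin.le_def, Fin.val_rev]
  simp; omega

theorem dvd_fromLast_one (hdvd : ∀ i j, i ≤ j → n i ∣ n j) (i : Fin r) (hi : (i : ℕ) + 1 < r) :
    n i ∣ fromLast n 1 := by
  have hr : 1 < r := by omega
  rw [fromLast, dif_pos hr]
  apply hdvd
  rw [Fin.le_def, Fin.val_rev]
  simp; omega

/-- A value other than the default 1 can only come from an actual invariant factor, whose index is
recovered here. -/
theorem exists_of_fromLast_ne_one {j : ℕ} (h : fromLast n j ≠ 1) :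
    ∃ i : Fin r, n i = fromLast n j ∧ (i : ℕ) + (j + 1) = r := by
  unfold fromLast at h ⊢
  split_ifs at h ⊢ with hj
  · refine ⟨_, rfl, ?_⟩
    rw [Fin.val_rev]
    simp; omega
  · exact absurd rfl h

end Characters

/-! ### Self-orthogonal codes spanned by characters -/

section Codes

variable {F G V : Type*} [Field F] [Group G] [Fintype G] [AddCommGroup V] [Module F V]

/-- A translation-stable, self-orthogonal space of class functions is the hull of a group code. -/
theorem exists_code_of_map (T : V →ₗ[F] G → F) (hT : Function.Injective T)
    (trans : ∀ v h, ∃ w, ∀ g, T v (h * g) = T w g)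
    (comm : ∀ v g h, T v (g * h) = T v (h * g))
    (orth : ∀ v w, ∑ g, T v g * T w g = 0) :
    ∃ C : Ideal (MonoidAlgebra F G), C.IsTwoSided ∧
      Module.finrank F (hull (C.restrictScalars F)) = Module.finrank F V := by
  let S : V →ₗ[F] MonoidAlgebra F G :=
    { toFun := fun v => .ofCoeff (Finsupp.equivFunOnFinite.symm (T v))
      map_add' := fun v w => by ext g; simp
      map_smul' := fun c v => by ext g; simp }
  have hS : ∀ v g, (S v).coeff g = T v g := fun v g => rfl
  have hSinj : Function.Injective S := fun v w h => hT <| by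
    funext g
    rw [← hS, ← hS, h]
  have left : ∀ a : MonoidAlgebra F G, ∀ v, ∃ w, a * S v = S w := by
    intro a v
    induction a using MonoidAlgebra.induction_linear with
    | zero => exact ⟨0, by simp⟩
    | add a b ha hb =>
      obtain ⟨w, hw⟩ := ha
      obtain ⟨w', hw'⟩ := hb
      exact ⟨w + w', by rw [add_mul, hw, hw', map_add]⟩
    | single h c =>
      obtain ⟨w, hw⟩ := trans v h⁻¹
      refine ⟨c • w, ?_⟩
      ext g
      simp [hS, hw, MonoidAlgebra.coeff_single_mul_apply]
  have right : ∀ a : MonoidAlgebra F G, ∀ v, ∃ w, S v * a = S w := by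
    intro a v
    induction a using MonoidAlgebra.induction_linear with
    | zero => exact ⟨0, by simp⟩
    | add a b ha hb =>
      obtain ⟨w, hw⟩ := ha
      obtain ⟨w', hw'⟩ := hb
      exact ⟨w + w', by rw [mul_add, hw, hw', map_add]⟩
    | single h c =>
      obtain ⟨w, hw⟩ := trans v h⁻¹
      refine ⟨c • w, ?_⟩
      ext g
      simp [hS, comm v g, hw, MonoidAlgebra.coeff_mul_single_apply, mul_comm]
  let C : Ideal (MonoidAlgebra F G) :=
    { carrier := Set.range S
      zero_mem' := ⟨0, map_zero S⟩
      add_mem' := by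
        rintro _ _ ⟨v, rfl⟩ ⟨w, rfl⟩
        exact ⟨v + w, map_add S v w⟩
      smul_mem' := by
        rintro a _ ⟨v, rfl⟩
        obtain ⟨w, hw⟩ := left a v
        exact ⟨w, hw.symm⟩ }
  refine ⟨C, ⟨?_⟩, ?_⟩
  · rintro _ b ⟨v, rfl⟩
    obtain ⟨w, hw⟩ := right b v
    exact ⟨w, hw.symm⟩
  -- `orth` says $C\subseteq C^\perp$, so the code is its own hull.
  · have : hull (C.restrictScalars F) = LinearMap.range S := by
      ext x
      constructor
      · rintro ⟨h, -⟩
        exact h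
      · rintro ⟨v, rfl⟩
        refine ⟨⟨v, rfl⟩, ?_⟩
        rintro _ ⟨w, rfl⟩
        exact orth w v
    rw [this, LinearMap.finrank_range_of_inj hSinj]

theorem sum_mul_eq_zero {K : Type*} [Field K] (χ ψ : G →* Kˣ) (h : ∃ g, χ g * ψ g ≠ 1) :
    ∑ g, (χ g : K) * ψ g = 0 := by
  have := sum_hom_units_eq_zero ((Units.coeHom K).comp (χ * ψ)) (fun h1 => by
    obtain ⟨g, hg⟩ := h
    exact hg (Units.ext (DFunLike.congr_fun h1 g)))
  simpa using this

/-- Dedekind's independence of characters, for two of them. -/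
theorem coeff_eq_zero_of_ne {K G : Type*} [Field K] [Group G] {χ ψ : G →* Kˣ} (h : ∃ g, χ g ≠ ψ g) {a b : K}
    (hab : ∀ g, a * χ g + b * ψ g = 0) : a = 0 ∧ b = 0 := by
  have hne : (Units.coeHom K).comp χ ≠ (Units.coeHom K).comp ψ := fun h1 => by
    obtain ⟨g, hg⟩ := h
    exact hg (Units.ext (DFunLike.congr_fun h1 g))
  have hli := (linearIndependent_monoidHom G K).comp
    ![(Units.coeHom K).comp χ, (Units.coeHom K).comp ψ] (by
      rw [Function.Injective]
      intro i j
      fin_cases i <;> fin_cases j <;> simp [hne, hne.symm])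
  rw [Fintype.linearIndependent_iff] at hli
  have := hli ![a, b] (by
    funext g
    simpa [Fin.sum_univ_two] using hab g)
  exact ⟨this 0, this 1⟩

/-- Two characters with `χ, χ⁻¹, ψ, ψ⁻¹` distinct give a group code with hull of dimension two. -/
theorem exists_code_of_pair (χ ψ : G →* Fˣ) (hχ : ∃ g, χ g * χ g ≠ 1) (hψ : ∃ g, ψ g * ψ g ≠ 1)
    (hne : ∃ g, χ g ≠ ψ g) (hmul : ∃ g, χ g * ψ g ≠ 1) :
    ∃ C : Ideal (MonoidAlgebra F G), C.IsTwoSided ∧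
      Module.finrank F (hull (C.restrictScalars F)) = 2 := by
  let T : F × F →ₗ[F] G → F :=
    { toFun := fun v g => v.1 * χ g + v.2 * ψ g
      map_add' := fun v w => by funext g; simp; ring
      map_smul' := fun c v => by funext g; simp; ring }
  have hT : ∀ v g, T v g = v.1 * χ g + v.2 * ψ g := fun v g => rfl
  have := exists_code_of_map T ?_ ?_ ?_ ?_
  · simpa using this
  · rw [injective_iff_map_eq_zero]
    intro v hv
    obtain ⟨h1, h2⟩ := coeff_eq_zero_of_ne hne (fun g => congrFun hv g)
    exact Prod.ext h1 h2
  · intro v h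
    refine ⟨(v.1 * χ h, v.2 * ψ h), fun g => ?_⟩
    simp only [hT, map_mul, Units.val_mul]
    ring
  · intro v g h
    simp only [hT, map_mul, Units.val_mul]
    ring
  · intro v w
    have h1 := sum_mul_eq_zero χ χ hχ
    have h2 := sum_mul_eq_zero ψ ψ hψ
    have h3 := sum_mul_eq_zero χ ψ hmul
    calc ∑ g, T v g * T w g = v.1 * w.1 * ∑ g, (χ g : F) * χ g + v.2 * w.2 * ∑ g, (ψ g : F) * ψ g
          + (v.1 * w.2 + v.2 * w.1) * ∑ g, (χ g : F) * ψ g := by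
            simp only [Finset.mul_sum, ← Finset.sum_add_distrib]
            refine Finset.sum_congr rfl fun g _ => ?_
            rw [hT, hT]
            ring
      _ = 0 := by rw [h1, h2, h3]; ring

/-- A character into the quadratic extension that is neither conjugate nor inverse to its
conjugate gives a group code with hull of dimension two. -/
theorem exists_code_of_quadratic [Finite F] {K : Type*} [Field K] [Finite K] [Algebra F K]
    (hK : Module.finrank F K = 2) (χ : G →* Kˣ) (h1 : ∃ g, χ g ^ (Nat.card F - 1) ≠ 1)
    (h2 : ∃ g, χ g ^ (Nat.card F + 1) ≠ 1) :
    ∃ C : Ideal (MonoidAlgebra F G), C.IsTwoSided ∧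
      Module.finrank F (hull (C.restrictScalars F)) = 2 := by
  set q := Nat.card F with hq
  have hq1 : 1 < q := Finite.one_lt_card
  let ψ : G →* Kˣ := (powMonoidHom q).comp χ
  have hψ : ∀ g, ψ g = χ g ^ q := fun g => rfl
  have hcard : Nat.card Kˣ = q ^ 2 - 1 := by
    rw [Nat.card_units, Module.natCard_eq_pow_finrank (K := F), hK]
  have hpow : ∀ u : Kˣ, u ^ (q ^ 2 - 1) = 1 := fun u => by
    rw [← hcard, pow_card_eq_one']
  have hq2 : 1 ≤ q ^ 2 := Nat.one_le_pow 2 q (by omega)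
  obtain ⟨g₁, hg₁⟩ := h1
  obtain ⟨g₂, hg₂⟩ := h2
  have hne : χ g₁ ≠ ψ g₁ := fun h => hg₁ <| by
    rw [hψ, ← Nat.sub_add_cancel hq1.le, pow_succ] at h
    exact right_eq_mul.1 h
  have hmul : χ g₂ * ψ g₂ ≠ 1 := by rwa [hψ, ← pow_succ']
  -- An element of order at most 2 satisfies $u^{q-1}=1$: for odd $q$ because $q-1$ is even, for
  -- even $q$ because $|K^\times|=q^2-1$ is odd and forces $u=1$.
  have hsq : χ g₁ * χ g₁ ≠ 1 := fun h => by
    rw [← sq] at h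
    rcases Nat.even_or_odd q with he | ho
    · obtain ⟨k, hk⟩ : Odd (q ^ 2 - 1) :=
        Nat.Even.sub_odd hq2 (he.pow_of_ne_zero two_ne_zero) odd_one
      have h3 := hpow (χ g₁)
      rw [hk, pow_succ, pow_mul, h, one_pow, one_mul] at h3
      exact hg₁ (by rw [h3, one_pow])
    · obtain ⟨k, hk⟩ := ho
      apply hg₁
      rw [hk, Nat.add_sub_cancel, pow_mul, h, one_pow]
  have hsq' : ψ g₁ * ψ g₁ ≠ 1 := fun h => hsq <| by
    have h3 : (χ g₁ ^ q) ^ q = χ g₁ := by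
      rw [← pow_mul, ← sq, ← Nat.sub_add_cancel hq2, pow_succ, hpow, one_mul]
    rw [hψ] at h
    rw [← h3, ← mul_pow, h, one_pow]
  -- Descent to $F$: the functions $g\mapsto\mathrm{Tr}(v\chi(g))=v\chi(g)+v^q\chi(g)^q$ are
  -- $F$-valued combinations of $\chi$ and its Frobenius conjugate `ψ`, parametrized by the
  -- 2-dimensional space $K$.
  let T : K →ₗ[F] G → F := LinearMap.pi fun g =>
    (Algebra.trace F K).comp (LinearMap.mulRight F (χ g : K))
  have hT : ∀ v g, T v g = Algebra.trace F K (v * χ g) := fun v g => rfl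
  have hT' : ∀ v g, algebraMap F K (T v g) = v * χ g + v ^ q * ψ g := fun v g => by
    rw [hT, FiniteField.algebraMap_trace_eq_sum_pow, hK]
    simp [Finset.sum_range_succ, mul_pow, hq, hψ]
  have := exists_code_of_map T ?_ ?_ ?_ ?_
  · rwa [hK] at this
  · rw [injective_iff_map_eq_zero]
    intro v hv
    exact (coeff_eq_zero_of_ne ⟨_, hne⟩ (a := v) (b := v ^ q) (fun g => by
      rw [← hT', hv, Pi.zero_apply, map_zero])).1
  · intro v h
    refine ⟨v * χ h, fun g => ?_⟩
    rw [hT, hT, χ.map_mul, Units.val_mul, mul_assoc]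
  · intro v g h
    rw [hT, hT, χ.map_mul, χ.map_mul, mul_comm (χ g)]
  · intro v w
    apply (algebraMap F K).injective
    have e1 := sum_mul_eq_zero χ χ ⟨_, hsq⟩
    have e2 := sum_mul_eq_zero ψ ψ ⟨_, hsq'⟩
    have e3 := sum_mul_eq_zero χ ψ ⟨_, hmul⟩
    rw [map_sum, map_zero]
    calc ∑ g, algebraMap F K (T v g * T w g) = v * w * ∑ g, (χ g : K) * χ g
          + v ^ q * w ^ q * ∑ g, (ψ g : K) * ψ g
          + (v * w ^ q + v ^ q * w) * ∑ g, (χ g : K) * ψ g := by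
            simp only [Finset.mul_sum, ← Finset.sum_add_distrib]
            refine Finset.sum_congr rfl fun g _ => ?_
            rw [map_mul, hT', hT']
            ring
      _ = 0 := by rw [e1, e2, e3]; ring

end Codes

/-! ### Two-dimensional ideals of semisimple algebras -/

section Semisimple

universe u

/-- In a semisimple ring every two-sided ideal is generated by a central idempotent. -/
theorem exists_central_idempotent {A : Type*} [Ring A] [IsSemisimpleRing A] (H : Ideal A)
    [H.IsTwoSided] : ∃ e ∈ H, (∀ x ∈ H, x * e = x) ∧ ∀ a, a * e = e * a := by
  obtain ⟨e, he, hH⟩ := IsSemisimpleRing.ideal_eq_span_idempotent H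
  have heH : e ∈ H := by
    rw [hH]
    exact Ideal.mem_span_singleton_self e
  have hr : ∀ x ∈ H, x * e = x := fun x hx => by
    rw [hH, Ideal.mem_span_singleton'] at hx
    obtain ⟨a, rfl⟩ := hx
    rw [mul_assoc, he.eq]
  -- `N` is the part of `H` killed by `H` on the left. It has square zero, so its idempotent
  -- generator vanishes; this turns the right identity `e` of `H` into a left identity.
  let N : Ideal A :=
    { carrier := {x | x ∈ H ∧ ∀ y ∈ H, y * x = 0}
      zero_mem' := ⟨H.zero_mem, fun y _ => mul_zero y⟩
      add_mem' := fun {x x'} hx hx' => ⟨H.add_mem hx.1 hx'.1, fun y hy => by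
        rw [mul_add, hx.2 y hy, hx'.2 y hy, add_zero]⟩
      smul_mem' := fun a x hx => ⟨H.mul_mem_left a hx.1, fun y hy => by
        rw [smul_eq_mul, ← mul_assoc]
        exact hx.2 _ (H.mul_mem_right a hy)⟩ }
  have hN : ∀ x ∈ N, x = 0 := fun x hx => by
    obtain ⟨f, hf, hNf⟩ := IsSemisimpleRing.ideal_eq_span_idempotent N
    have hfN : f ∈ N := by
      rw [hNf]
      exact Ideal.mem_span_singleton_self f
    have hf0 : f = 0 := by
      rw [← hf.eq]
      exact hfN.2 f hfN.1
    rw [hNf, hf0, Ideal.mem_span_singleton'] at hx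
    obtain ⟨a, rfl⟩ := hx
    exact mul_zero a
  have hl : ∀ x ∈ H, e * x = x := fun x hx => by
    have : x - e * x ∈ N := ⟨H.sub_mem hx (H.mul_mem_left e hx), fun y hy => by
      rw [mul_sub, ← mul_assoc, hr y hy, sub_self]⟩
    exact (sub_eq_zero.1 (hN _ this)).symm
  refine ⟨e, heH, hr, fun a => ?_⟩
  rw [← hr _ (H.mul_mem_right a heH), mul_assoc, hl _ (H.mul_mem_left a heH)]

variable {F : Type*} [Field F]

/-- If `x` is not a scalar, then $1,x$ is a basis, so every element is a polynomial in `x`. -/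
theorem mul_comm_of_finrank_eq_two {B : Type*} [Ring B] [Algebra F B]
    (hB : Module.finrank F B = 2) (x y : B) : x * y = y * x := by
  have : Nontrivial B := Module.nontrivial_of_finrank_pos (R := F) (by omega)
  by_cases h : ∃ a : F, a • (1 : B) = x
  · obtain ⟨a, rfl⟩ := h
    simp
  · push Not at h
    have : Module.Finite F B := Module.finite_of_finrank_pos (by omega)
    have hli := (LinearIndependent.pair_iff' (K := F) (one_ne_zero (α := B))).2 h
    have hsp := hli.span_eq_top_of_card_eq_finrank' (by simp [hB])
    have hy : y ∈ Submodule.span F (Set.range ![1, x]) := hsp ▸ Submodule.mem_top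
    rw [Matrix.range_cons_cons_empty, Submodule.mem_span_pair] at hy
    obtain ⟨a, b, rfl⟩ := hy
    simp [mul_add, add_mul]

theorem exists_algHom_of_finrank_quotient_eq_one {B : Type*} [CommRing B] [Algebra F B]
    (M : Ideal B) (h : Module.finrank F (B ⧸ M) = 1) :
    ∃ χ : B →ₐ[F] F, ∀ x, χ x = 0 ↔ x ∈ M := by
  have : Nontrivial (B ⧸ M) := Module.nontrivial_of_finrank_pos (R := F) (by omega)
  have hbij : Function.Bijective (Algebra.ofId F (B ⧸ M)) := by
    refine ⟨(algebraMap F (B ⧸ M)).injective, ?_⟩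
    have := Subalgebra.bot_eq_top_iff_finrank_eq_one.2 h
    exact Algebra.surjective_algebraMap_iff.2 this.symm
  let ε := AlgEquiv.ofBijective _ hbij
  refine ⟨ε.symm.toAlgHom.comp (Ideal.Quotient.mkₐ F M), fun x => ?_⟩
  have : (ε.symm.toAlgHom.comp (Ideal.Quotient.mkₐ F M)) x = ε.symm (Ideal.Quotient.mk M x) := rfl
  rw [this, map_eq_zero_iff _ ε.symm.injective, Ideal.Quotient.eq_zero_iff_mem]

/-- A reduced local Artinian ring is a field. Otherwise there are two maximal ideals, both nonzero,
so in dimension 2 each has residue field $F$ and gives a character. -/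
theorem isField_or_exists_algHom_ne {B : Type*} [CommRing B] [Algebra F B] [IsReduced B]
    (hB : Module.finrank F B = 2) :
    IsField B ∨ ∃ χ ψ : B →ₐ[F] F, χ ≠ ψ := by
  have : Nontrivial B := Module.nontrivial_of_finrank_pos (R := F) (by omega)
  have : Module.Finite F B := Module.finite_of_finrank_pos (by omega)
  have : IsArtinianRing B := IsArtinianRing.of_finite F B
  by_cases hloc : IsLocalRing B
  · exact Or.inl (IsArtinianRing.isField_of_isReduced_of_isLocalRing B)
  · right
    obtain ⟨M, hM⟩ := Ideal.exists_maximal B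
    have : ∃ N : Ideal B, N.IsMaximal ∧ N ≠ M := by
      by_contra! hcon
      exact hloc (IsLocalRing.of_unique_max_ideal ⟨M, hM, hcon⟩)
    obtain ⟨N, hN, hne⟩ := this
    have hrank : ∀ I J : Ideal B, I.IsMaximal → J.IsMaximal → I ≠ J →
        Module.finrank F (B ⧸ I) = 1 := by
      intro I J hI hJ hIJ
      have h1 : I ≠ ⊥ := by
        rintro rfl
        exact hIJ (hI.eq_of_le hJ.ne_top bot_le)
      have h2 := Submodule.finrank_quotient_add_finrank (I.restrictScalars F)
      have h3 : Module.finrank F (I.restrictScalars F) ≠ 0 := by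
        rw [Ne, Submodule.finrank_eq_zero, Submodule.restrictScalars_eq_bot_iff]
        exact h1
      have h4 : 0 < Module.finrank F (B ⧸ I) := by
        have := Ideal.Quotient.nontrivial_iff.2 hI.ne_top
        exact Module.finrank_pos
      have h5 : Module.finrank F (B ⧸ I.restrictScalars F) = Module.finrank F (B ⧸ I) :=
        (Submodule.Quotient.restrictScalarsEquiv F I).finrank_eq
      omega
    obtain ⟨χ, hχ⟩ := exists_algHom_of_finrank_quotient_eq_one M (hrank M N hM hN hne.symm)
    obtain ⟨ψ, hψ⟩ := exists_algHom_of_finrank_quotient_eq_one N (hrank N M hN hM hne)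
    refine ⟨χ, ψ, fun h => hne ?_⟩
    ext x
    rw [← hψ, ← hχ, h]

/-- A two-dimensional two-sided ideal of a semisimple algebra corresponds to a quadratic field
extension or to two distinct characters. -/
theorem exists_algHom_of_finrank_eq_two {A : Type u} [Ring A] [Algebra F A] [Module.Finite F A]
    [IsSemisimpleRing A] (H : Ideal A) [H.IsTwoSided]
    (hH : Module.finrank F (H.restrictScalars F) = 2) :
    ∃ e ∈ H, (∃ (K : Type u) (_ : Field K) (_ : Algebra F K) (φ : A →ₐ[F] K),
        Function.Surjective φ ∧ Module.finrank F K = 2 ∧ φ e = 1) ∨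
      ∃ χ ψ : A →ₐ[F] F, χ ≠ ψ ∧ χ e = 1 ∧ ψ e = 1 := by
  obtain ⟨e, heH, hr, hc⟩ := exists_central_idempotent H
  let J : Ideal A :=
    { carrier := {a | a * e = 0}
      zero_mem' := zero_mul e
      add_mem' := fun {a b} (ha : a * e = 0) (hb : b * e = 0) =>
        show (a + b) * e = 0 by rw [add_mul, ha, hb, add_zero]
      smul_mem' := fun c a (ha : a * e = 0) =>
        show c * a * e = 0 by rw [mul_assoc, ha, mul_zero] }
  have : J.IsTwoSided := ⟨fun {a} b (ha : a * e = 0) =>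
    show a * b * e = 0 by rw [mul_assoc, hc, ← mul_assoc, ha, zero_mul]⟩
  have hJ : ∀ a, a ∈ J ↔ a * e = 0 := fun a => Iff.rfl
  let π : A →ₐ[F] A ⧸ J := Ideal.Quotient.mkₐ F J
  have hπ : Function.Surjective π := Ideal.Quotient.mkₐ_surjective F J
  have hss : IsSemisimpleRing (A ⧸ J) := RingHom.isSemisimpleRing_of_surjective π.toRingHom hπ
  have hπe : π e = 1 := by
    rw [← map_one π]
    refine (Ideal.Quotient.mk_eq_mk_iff_sub_mem _ _).2 ?_
    rw [hJ, sub_mul, hr e heH, one_mul, sub_self]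
  -- Rank-nullity for $a\mapsto ae$, which has kernel `J` and image `H`.
  have hrank : Module.finrank F (A ⧸ J) = 2 := by
    have h1 := (LinearMap.mulRight F e).finrank_range_add_finrank_ker
    have h2 := π.toLinearMap.finrank_range_add_finrank_ker
    have h3 : LinearMap.ker π.toLinearMap = LinearMap.ker (LinearMap.mulRight F e) := by
      ext a
      rw [LinearMap.mem_ker, LinearMap.mem_ker, LinearMap.mulRight_apply, ← hJ]
      exact Ideal.Quotient.eq_zero_iff_mem
    have h4 : LinearMap.range (LinearMap.mulRight F e) = H.restrictScalars F := by
      ext x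
      constructor
      · rintro ⟨a, rfl⟩
        exact H.mul_mem_left a heH
      · intro hx
        exact ⟨x, hr x hx⟩
    rw [LinearMap.range_eq_top.2 hπ, finrank_top, h3] at h2
    rw [h4, hH] at h1
    omega
  let cr : CommRing (A ⧸ J) :=
    { (inferInstance : Ring (A ⧸ J)) with
      mul_comm := mul_comm_of_finrank_eq_two hrank }
  refine ⟨e, heH, ?_⟩
  rcases isField_or_exists_algHom_ne hrank with hf | ⟨χ, ψ, hne⟩
  · left
    let fld : Field (A ⧸ J) := hf.toField
    exact ⟨A ⧸ J, fld, inferInstance, π, hπ, hrank, hπe⟩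
  · right
    refine ⟨χ.comp π, ψ.comp π, fun h => hne ?_, ?_, ?_⟩
    · ext x
      obtain ⟨a, rfl⟩ := hπ x
      exact DFunLike.congr_fun h a
    · rw [AlgHom.comp_apply, hπe, map_one]
    · rw [AlgHom.comp_apply, hπe, map_one]

end Semisimple

/-! ### The hull as an ideal, and orthogonality under the involution -/

section Hull

variable {F G : Type*} [Field F] [Group G] [Fintype G]

theorem euclid_single_mul (h : G) (c : F) (x y : MonoidAlgebra F G) :
    euclid x (MonoidAlgebra.single h c * y) = euclid (MonoidAlgebra.single h⁻¹ c * x) y := by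
  unfold euclid
  refine Fintype.sum_equiv (Equiv.mulLeft h⁻¹) _ _ fun g => ?_
  simp
  ring

theorem euclid_mul_single (h : G) (c : F) (x y : MonoidAlgebra F G) :
    euclid x (y * MonoidAlgebra.single h c) = euclid (x * MonoidAlgebra.single h⁻¹ c) y := by
  unfold euclid
  refine Fintype.sum_equiv (Equiv.mulRight h⁻¹) _ _ fun g => ?_
  simp
  ring

theorem mul_mem_dual {C : Ideal (MonoidAlgebra F G)} {y : MonoidAlgebra F G}
    (hy : y ∈ dual (C.restrictScalars F)) (a : MonoidAlgebra F G) :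
    a * y ∈ dual (C.restrictScalars F) := by
  induction a using MonoidAlgebra.induction_linear with
  | zero => rw [zero_mul]; exact Submodule.zero_mem _
  | add a b ha hb => rw [add_mul]; exact Submodule.add_mem _ ha hb
  | single h c =>
    intro x hx
    rw [euclid_single_mul]
    exact hy _ (C.mul_mem_left _ hx)

theorem mem_dual_mul {C : Ideal (MonoidAlgebra F G)} [C.IsTwoSided] {y : MonoidAlgebra F G}
    (hy : y ∈ dual (C.restrictScalars F)) (a : MonoidAlgebra F G) :
    y * a ∈ dual (C.restrictScalars F) := by
  induction a using MonoidAlgebra.induction_linear with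
  | zero => rw [mul_zero]; exact Submodule.zero_mem _
  | add a b ha hb => rw [mul_add]; exact Submodule.add_mem _ ha hb
  | single h c =>
    intro x hx
    rw [euclid_mul_single]
    exact hy _ (C.mul_mem_right _ hx)

/-- The hull of a group code is a two-sided ideal. -/
theorem exists_ideal_eq_hull (C : Ideal (MonoidAlgebra F G)) [C.IsTwoSided] :
    ∃ H : Ideal (MonoidAlgebra F G), H.IsTwoSided ∧
      H.restrictScalars F = hull (C.restrictScalars F) := by
  let H : Ideal (MonoidAlgebra F G) :=
    { carrier := hull (C.restrictScalars F)
      zero_mem' := Submodule.zero_mem _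
      add_mem' := fun ha hb => Submodule.add_mem _ ha hb
      smul_mem' := fun a x hx => ⟨C.mul_mem_left a hx.1, mul_mem_dual hx.2 a⟩ }
  exact ⟨H, ⟨fun b hx => ⟨C.mul_mem_right b hx.1, mem_dual_mul hx.2 b⟩⟩, rfl⟩

/-- The conjugate of an algebra homomorphism under the involution `g ↦ g⁻¹`. -/
noncomputable def conjHom {B : Type*} [CommRing B] [Algebra F B] (φ : MonoidAlgebra F G →ₐ[F] B) :
    MonoidAlgebra F G →ₐ[F] B :=
  MonoidAlgebra.lift F B G
    { toFun := fun g => φ (MonoidAlgebra.single g⁻¹ 1)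
      map_one' := by
        rw [inv_one]
        exact map_one φ
      map_mul' := fun g h => by
        rw [mul_inv_rev, mul_comm (φ _), ← map_mul, MonoidAlgebra.single_mul_single, one_mul] }

omit [Fintype G] in
theorem conjHom_single {B : Type*} [CommRing B] [Algebra F B] (φ : MonoidAlgebra F G →ₐ[F] B)
    (g : G) : conjHom φ (MonoidAlgebra.single g 1) = φ (MonoidAlgebra.single g⁻¹ 1) := by
  rw [conjHom, MonoidAlgebra.lift_single, one_smul]
  rfl

theorem algHom_eq_sum {B : Type*} [CommRing B] [Algebra F B] (φ : MonoidAlgebra F G →ₐ[F] B)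
    (x : MonoidAlgebra F G) : φ x = ∑ g, x.coeff g • φ (MonoidAlgebra.single g 1) := by
  rw [MonoidAlgebra.lift_unique, Finsupp.sum_fintype]
  simp

/-- In the expanded product the coefficient at $k$ is $\langle k^{-1}x,y\rangle$, which vanishes
because $C$ is stable under translation. -/
theorem mul_conjHom_eq_zero {B : Type*} [CommRing B] [Algebra F B]
    (φ : MonoidAlgebra F G →ₐ[F] B) (C : Ideal (MonoidAlgebra F G)) {x y : MonoidAlgebra F G}
    (hx : x ∈ C) (hy : y ∈ dual (C.restrictScalars F)) : φ x * conjHom φ y = 0 := by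
  have h0 : ∀ k : G, ∑ h, x.coeff (k * h) * y.coeff h = 0 := fun k => by
    have := hy _ (C.mul_mem_left (MonoidAlgebra.single k⁻¹ 1) hx)
    simpa [euclid] using this
  calc φ x * conjHom φ y
      = ∑ h, ∑ g, (x.coeff g * y.coeff h) • φ (MonoidAlgebra.single (g * h⁻¹) 1) := by
        rw [algHom_eq_sum φ x, algHom_eq_sum (conjHom φ) y, Finset.sum_mul_sum, Finset.sum_comm]
        refine Finset.sum_congr rfl fun h _ => Finset.sum_congr rfl fun g _ => ?_
        rw [conjHom_single, smul_mul_smul_comm, ← map_mul, MonoidAlgebra.single_mul_single, one_mul]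
    _ = ∑ h, ∑ k, (x.coeff (k * h) * y.coeff h) • φ (MonoidAlgebra.single k 1) := by
        refine Finset.sum_congr rfl fun h _ => ?_
        refine Fintype.sum_equiv (Equiv.mulRight h⁻¹) _ _ fun g => ?_
        simp
    _ = 0 := by
        rw [Finset.sum_comm]
        refine Finset.sum_eq_zero fun k _ => ?_
        rw [← Finset.sum_smul, h0, zero_smul]

end Hull

/-! ### Necessity of the gcd conditions -/

section Main

variable {F G : Type*} [Field F] [Group G] {r : ℕ} {n : Fin r → ℕ}

/-- The character of `G` underlying an algebra homomorphism on `F[G]`. -/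
noncomputable def charOf {K : Type*} [Field K] [Algebra F K] (φ : MonoidAlgebra F G →ₐ[F] K) :
    G →* Kˣ :=
  MonoidHom.toHomUnits ((φ : MonoidAlgebra F G →* K).comp (MonoidAlgebra.of F G))

theorem coe_charOf {K : Type*} [Field K] [Algebra F K] (φ : MonoidAlgebra F G →ₐ[F] K) (g : G) :
    (charOf φ g : K) = φ (MonoidAlgebra.single g 1) := rfl

theorem algHom_eq_of_single {K : Type*} [CommRing K] [Algebra F K]
    {φ ψ : MonoidAlgebra F G →ₐ[F] K}
    (h : ∀ g, φ (MonoidAlgebra.single g 1) = ψ (MonoidAlgebra.single g 1)) : φ = ψ :=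
  MonoidAlgebra.algHom_ext h (by ext)

theorem coe_charOf_inv {K : Type*} [Field K] [Algebra F K] (φ : MonoidAlgebra F G →ₐ[F] K)
    (g : G) : ((charOf φ g)⁻¹ : Kˣ) = conjHom φ (MonoidAlgebra.single g 1) := by
  rw [conjHom_single, ← map_inv, coe_charOf]

/-- Character values are killed both by $n_r$, a multiple of every $n_i$, and by $|K^\times|$. -/
theorem character_pow_gcd_eq_one {K : Type*} [Field K] [Finite K]
    (e : Additive (Abelianization G) ≃+ (∀ i, ZMod (n i))) (hdvd : ∀ i j, i ≤ j → n i ∣ n j)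
    (χ : G →* Kˣ) (g : G) : χ g ^ Nat.gcd (fromLast n 0) (Nat.card K - 1) = 1 := by
  refine pow_gcd_eq_one.2 ⟨apply_pow_eq_one e χ (dvd_fromLast_zero hdvd) g, ?_⟩
  rw [← Nat.card_units, pow_card_eq_one']

/-- If `χ, χ⁻¹, ψ, ψ⁻¹` are distinct characters of `G`, the group of characters with values in `F`
is not cyclic of order at most four. -/
theorem gcd_of_pair [Finite F] (e : Additive (Abelianization G) ≃+ (∀ i, ZMod (n i)))
    (hdvd : ∀ i j, i ≤ j → n i ∣ n j) (χ ψ : G →* Fˣ)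
    (hχ : ∃ g, χ g * χ g ≠ 1) (hψ : ∃ g, ψ g * ψ g ≠ 1)
    (hne : ∃ g, χ g ≠ ψ g) (hmul : ∃ g, χ g * ψ g ≠ 1) :
    5 ≤ Nat.gcd (fromLast n 0) (Nat.card F - 1) ∨
      (3 ≤ Nat.gcd (fromLast n 0) (Nat.card F - 1) ∧
        Nat.gcd (fromLast n 0) (Nat.card F - 1) ≤ 4 ∧
        2 ≤ Nat.gcd (fromLast n 1) (Nat.card F - 1)) := by
  have hq : 1 < Nat.card F := Finite.one_lt_card
  have hpos : ∀ m, 0 < Nat.gcd m (Nat.card F - 1) := fun m => Nat.gcd_pos_of_pos_right m (by omega)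
  have hexp := character_pow_gcd_eq_one (K := F) e hdvd
  set a := Nat.gcd (fromLast n 0) (Nat.card F - 1) with ha
  have ha0 : 0 < a := hpos _
  have ha3 : 3 ≤ a := by
    by_contra hlt
    obtain ⟨g, hg⟩ := hχ
    have h1 := hexp χ g
    apply hg
    obtain h | h : a = 1 ∨ a = 2 := by omega
    · rw [h, pow_one] at h1
      rw [h1, one_mul]
    · rwa [h, sq] at h1
  rcases Nat.lt_or_ge 4 a with h5 | h4
  · exact Or.inl h5
  refine Or.inr ⟨ha3, h4, ?_⟩
  by_contra hb
  have hb1 : Nat.gcd (fromLast n 1) (Nat.card F - 1) = 1 := by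
    have := hpos (fromLast n 1)
    omega
  have hN : fromLast n 0 ≠ 1 := fun h1 => by
    rw [ha, h1, Nat.gcd_one_left] at ha3
    omega
  obtain ⟨i, -, hi⟩ := exists_of_fromLast_ne_one hN
  obtain ⟨g₀, hg₀⟩ := exists_generator e i
  -- On every generator but the last, the order of the value divides $\gcd(n_{r-1},q-1)=1$. So a
  -- character is determined by its value at `g₀`.
  have det : ∀ θ : G →* Fˣ, θ g₀ = 1 → ∀ g, θ g = 1 := fun θ hθ g => by
    have : θ = 1 := by
      refine eq_one_of_generators e θ fun j g hg => ?_
      by_cases hji : j = i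
      · subst hji
        have h1 := coordHom_apply e θ g
        rw [hg, ← hg₀, coordHom_apply e θ g₀, hθ] at h1
        exact h1.symm
      · have hj : (j : ℕ) + 1 < r := by
          have := Fin.val_ne_of_ne hji
          have := j.isLt
          omega
        obtain ⟨k, hk⟩ := dvd_fromLast_one hdvd j hj
        have h1 : θ g ^ fromLast n 1 = 1 := by
          rw [hk, pow_mul, apply_pow_eq_one_of_generator e θ j hg, one_pow]
        have h2 : θ g ^ (Nat.card F - 1) = 1 := by rw [← Nat.card_units, pow_card_eq_one']
        have h3 := pow_gcd_eq_one.2 ⟨h1, h2⟩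
        rwa [hb1, pow_one] at h3
    rw [this, MonoidHom.one_apply]
  have hu : χ g₀ * χ g₀ ≠ 1 := fun h => hχ.elim fun g hg => hg (det (χ * χ) h g)
  have hv : ψ g₀ * ψ g₀ ≠ 1 := fun h => hψ.elim fun g hg => hg (det (ψ * ψ) h g)
  have huv : χ g₀ * ψ g₀ ≠ 1 := fun h => hmul.elim fun g hg => hg (det (χ * ψ) h g)
  have hdiv : χ g₀ ≠ ψ g₀ := fun h => hne.elim fun g hg =>
    hg (div_eq_one.1 (det (χ / ψ) (div_eq_one.2 h) g))
  have hua := hexp χ g₀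
  have hva := hexp ψ g₀
  generalize χ g₀ = u at *
  generalize ψ g₀ = v at *
  rw [Ne, Units.ext_iff, Units.val_mul, Units.val_one] at hu hv huv
  rw [Ne, Units.ext_iff] at hdiv
  rw [Units.ext_iff, Units.val_pow_eq_pow_val, Units.val_one] at hua hva
  generalize (u : F) = x at *
  generalize (v : F) = y at *
  have hxy : x - y ≠ 0 := sub_ne_zero.2 hdiv
  -- The distinct values `x`, `y` are the two roots of $z^2+z+1$ or of $z^2+1$. In both cases their
  -- product is 1, against `huv`.
  obtain h | h : a = 3 ∨ a = 4 := by omega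
  · rw [h] at hua hva
    have key : ∀ z : F, z * z ≠ 1 → z ^ 3 = 1 → z ^ 2 + z + 1 = 0 := fun z hz hz3 => by
      have hz1 : z - 1 ≠ 0 := fun h1 => hz (by rw [sub_eq_zero.1 h1, one_mul])
      refine (mul_eq_zero.1 (?_ : (z - 1) * (z ^ 2 + z + 1) = 0)).resolve_left hz1
      linear_combination hz3
    have h1 := key x hu hua
    have h2 : x + y + 1 = 0 := by
      refine (mul_eq_zero.1 (?_ : (x - y) * (x + y + 1) = 0)).resolve_left hxy
      linear_combination h1 - key y hv hva
    exact huv (by linear_combination x * h2 - h1)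
  · rw [h] at hua hva
    have key : ∀ z : F, z * z ≠ 1 → z ^ 4 = 1 → z ^ 2 + 1 = 0 := fun z hz hz4 => by
      have hz1 : z * z - 1 ≠ 0 := sub_ne_zero.2 hz
      refine (mul_eq_zero.1 (?_ : (z * z - 1) * (z ^ 2 + 1) = 0)).resolve_left hz1
      linear_combination hz4
    have h1 := key x hu hua
    have h2 : x + y = 0 := by
      refine (mul_eq_zero.1 (?_ : (x - y) * (x + y) = 0)).resolve_left hxy
      linear_combination h1 - key y hv hva
    exact huv (by linear_combination x * h2 - h1)

/-- If `F[G]` maps onto a quadratic extension of `F` and some `x` with `φ x = 1` is killed by the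
conjugate of `φ`, then the exponent of the abelianization has common factors with `q ^ 2 - 1`
beyond those with `q - 1` and with `q + 1`. -/
theorem gcd_of_quadratic [Finite F] {K : Type*} [Field K] [Algebra F K]
    (hK : Module.finrank F K = 2) (e : Additive (Abelianization G) ≃+ (∀ i, ZMod (n i)))
    (hdvd : ∀ i j, i ≤ j → n i ∣ n j) (φ : MonoidAlgebra F G →ₐ[F] K)
    (hφ : Function.Surjective φ)
    (x : MonoidAlgebra F G) (hx : φ x = 1) (hx' : conjHom φ x = 0) :
    Nat.gcd (fromLast n 0) (Nat.card F - 1) < Nat.gcd (fromLast n 0) (Nat.card F ^ 2 - 1) ∧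
      Nat.gcd (fromLast n 0) (Nat.card F + 1) <
        Nat.gcd (fromLast n 0) (Nat.card F ^ 2 - 1) := by
  have := Module.finite_of_finrank_pos (R := F) (M := K) (by omega)
  have : Finite K := Module.finite_of_finite F
  have : Fintype F := Fintype.ofFinite F
  have hcard : Nat.card K = Nat.card F ^ 2 := by
    rw [Module.natCard_eq_pow_finrank (K := F), hK]
  have hexp := character_pow_gcd_eq_one (K := K) e hdvd (charOf φ)
  rw [hcard] at hexp
  set q := Nat.card F with hq
  have hq1 : 1 < q := Finite.one_lt_card
  have hfac : q ^ 2 - 1 = (q + 1) * (q - 1) := by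
    have := Nat.sq_sub_sq q 1
    simpa using this
  have hpow : ∀ m, m ∣ q ^ 2 - 1 →
      ¬ Nat.gcd (fromLast n 0) m < Nat.gcd (fromLast n 0) (q ^ 2 - 1) →
      ∀ g, charOf φ g ^ m = 1 := fun m hm hlt g => by
    have h1 : Nat.gcd (fromLast n 0) m = Nat.gcd (fromLast n 0) (q ^ 2 - 1) :=
      le_antisymm (Nat.le_of_dvd (Nat.gcd_pos_of_pos_right _ (by
        rw [hfac]
        exact Nat.mul_pos (by omega) (by omega))) (Nat.gcd_dvd_gcd_of_dvd_right _ hm)) (not_lt.1 hlt)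
    obtain ⟨k, hk⟩ := Nat.gcd_dvd_right (fromLast n 0) m
    rw [hk, pow_mul, h1, hexp, one_pow]
  let σ := FiniteField.frobeniusAlgHom F K
  have hσ : ∀ y, σ y = y ^ q := fun y => by
    rw [hq, Nat.card_eq_fintype_card]
    rfl
  have hσg : ∀ g, σ (φ (MonoidAlgebra.single g 1)) = ((charOf φ g ^ q : Kˣ) : K) := fun g => by
    rw [hσ, Units.val_pow_eq_pow_val, coe_charOf]
  constructor
  -- Otherwise all character values are fixed by Frobenius; since `φ` is onto, Frobenius would be
  -- trivial on $K$, though it has order 2.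
  · by_contra hlt
    have h1 := hpow (q - 1) (hfac ▸ dvd_mul_left _ _) hlt
    have h2 : σ.comp φ = φ := algHom_eq_of_single fun g => by
      rw [AlgHom.comp_apply, hσg, ← Nat.sub_add_cancel hq1.le, pow_succ, h1, one_mul, coe_charOf]
    have h3 : σ = 1 := by
      ext y
      obtain ⟨z, rfl⟩ := hφ y
      exact DFunLike.congr_fun h2 z
    have h4 := FiniteField.orderOf_frobeniusAlgHom F K
    rw [show FiniteField.frobeniusAlgHom F K = 1 from h3, orderOf_one, hK] at h4
    omega
  -- Otherwise Frobenius inverts the character values, so $\overline\varphi$ is Frobenius after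
  -- $\varphi$ and sends `x` to 1, not 0.
  · by_contra hlt
    have h1 := hpow (q + 1) (hfac ▸ dvd_mul_right _ _) hlt
    have h2 : σ.comp φ = conjHom φ := algHom_eq_of_single fun g => by
      have h3 := h1 g
      rw [pow_succ, ← eq_inv_iff_mul_eq_one] at h3
      rw [AlgHom.comp_apply, hσg, h3, coe_charOf_inv]
    rw [← h2, AlgHom.comp_apply, hx, map_one] at hx'
    exact one_ne_zero hx'

theorem gcd_of_exists_code [Finite F] [Fintype G] (hcop : Nat.Coprime (Nat.card G) (Nat.card F))
    (e : Additive (Abelianization G) ≃+ (∀ i, ZMod (n i))) (hdvd : ∀ i j, i ≤ j → n i ∣ n j)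
    (C : Ideal (MonoidAlgebra F G)) [C.IsTwoSided]
    (hC : Module.finrank F (hull (C.restrictScalars F)) = 2) :
    5 ≤ Nat.gcd (fromLast n 0) (Nat.card F - 1) ∨
      (3 ≤ Nat.gcd (fromLast n 0) (Nat.card F - 1) ∧
        Nat.gcd (fromLast n 0) (Nat.card F - 1) ≤ 4 ∧
        2 ≤ Nat.gcd (fromLast n 1) (Nat.card F - 1)) ∨
      (Nat.gcd (fromLast n 0) (Nat.card F - 1) < Nat.gcd (fromLast n 0) (Nat.card F ^ 2 - 1) ∧
        Nat.gcd (fromLast n 0) (Nat.card F + 1) <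
          Nat.gcd (fromLast n 0) (Nat.card F ^ 2 - 1)) := by
  -- Maschke's condition, from which instance search gets semisimplicity of $F[G]$.
  have hcard : NeZero (Nat.card G : F) := ⟨fun h0 => by
    have : Fintype F := Fintype.ofFinite F
    obtain ⟨p, hp⟩ := CharP.exists F
    obtain ⟨k, hprime, hk⟩ := FiniteField.card F p
    rw [CharP.cast_eq_zero_iff F p] at h0
    have h1 : p ∣ Nat.card F := by
      rw [Nat.card_eq_fintype_card, hk]
      exact dvd_pow_self p k.pos.ne'
    exact Nat.not_coprime_of_dvd_of_dvd hprime.one_lt h0 h1 hcop⟩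
  obtain ⟨H, hH2, hH⟩ := exists_ideal_eq_hull C
  rw [← hH] at hC
  obtain ⟨x, hxH, hx⟩ := exists_algHom_of_finrank_eq_two H hC
  have hxC : x ∈ hull (C.restrictScalars F) := hH ▸ hxH
  rcases hx with ⟨K, _, _, φ, hφ, hK, hφx⟩ | ⟨φ₁, φ₂, hne, h1, h2⟩
  · refine Or.inr (Or.inr ?_)
    have := mul_conjHom_eq_zero φ C hxC.1 hxC.2
    rw [hφx, one_mul] at this
    exact gcd_of_quadratic hK e hdvd φ hφ x hφx this
  · rw [← or_assoc]
    left
    have hprod : ∀ φ ψ : MonoidAlgebra F G →ₐ[F] F, φ x = 1 → ψ x = 1 →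
        ∃ g, charOf φ g * charOf ψ g ≠ 1 := fun φ ψ hφ hψ => by
      by_contra! hall
      have h3 : conjHom φ = ψ := algHom_eq_of_single fun g => by
        rw [← coe_charOf_inv, inv_eq_of_mul_eq_one_right (hall g), coe_charOf]
      have h4 := mul_conjHom_eq_zero φ C hxC.1 hxC.2
      rw [h3, hφ, hψ, one_mul] at h4
      exact one_ne_zero h4
    refine gcd_of_pair e hdvd (charOf φ₁) (charOf φ₂) (hprod _ _ h1 h1) (hprod _ _ h2 h2) ?_
      (hprod _ _ h1 h2)
    by_contra! hall
    exact hne (algHom_eq_of_single fun g => by rw [← coe_charOf, hall g, coe_charOf])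

/-! ### Sufficiency: characters with prescribed values -/

/-- A finite field contains units of every order dividing `|K| - 1`. -/
theorem exists_unit_orderOf {K : Type*} [Field K] [Finite K] {d : ℕ} (hd : d ∣ Nat.card K - 1) :
    ∃ ζ : Kˣ, orderOf ζ = d := by
  obtain ⟨u, hu⟩ := IsCyclic.exists_ofOrder_eq_natCard (α := Kˣ)
  rw [Nat.card_units] at hu
  obtain ⟨k, hk⟩ := hd
  have hpos : 0 < Nat.card K - 1 := by
    have : 1 < Nat.card K := Finite.one_lt_card
    omega
  refine ⟨u ^ k, ?_⟩
  have hk0 : k ≠ 0 := by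
    rintro rfl
    omega
  rw [orderOf_pow_of_dvd hk0 (by rw [hu, hk]; exact dvd_mul_left _ _), hu, hk,
    Nat.mul_div_cancel _ (Nat.pos_of_ne_zero hk0)]

theorem pow_eq_one_of_orderOf_eq_gcd {M : Type*} [Monoid M] {ζ : M} {m d : ℕ}
    (hζ : orderOf ζ = Nat.gcd m d) : ζ ^ m = 1 := by
  rw [← orderOf_dvd_iff_pow_eq_one, hζ]
  exact Nat.gcd_dvd_left m d

theorem exists_code_of_gcd [Finite F] [Fintype G]
    (e : Additive (Abelianization G) ≃+ (∀ i, ZMod (n i)))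
    (h : 5 ≤ Nat.gcd (fromLast n 0) (Nat.card F - 1) ∨
      (3 ≤ Nat.gcd (fromLast n 0) (Nat.card F - 1) ∧
        Nat.gcd (fromLast n 0) (Nat.card F - 1) ≤ 4 ∧
        2 ≤ Nat.gcd (fromLast n 1) (Nat.card F - 1)) ∨
      (Nat.gcd (fromLast n 0) (Nat.card F - 1) < Nat.gcd (fromLast n 0) (Nat.card F ^ 2 - 1) ∧
        Nat.gcd (fromLast n 0) (Nat.card F + 1) <
          Nat.gcd (fromLast n 0) (Nat.card F ^ 2 - 1))) :
    ∃ C : Ideal (MonoidAlgebra F G), C.IsTwoSided ∧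
      Module.finrank F (hull (C.restrictScalars F)) = 2 := by
  have hlt : ∀ {ζ : Fˣ} {k : ℕ}, k ≠ 0 → k < orderOf ζ → ζ ^ k ≠ 1 := fun hk h1 =>
    pow_ne_one_of_lt_orderOf hk h1
  rcases h with h | ⟨h3, -, h2⟩ | ⟨h1, h2⟩
  · obtain ⟨ζ, hζ⟩ := exists_unit_orderOf (K := F) (Nat.gcd_dvd_right (fromLast n 0) _)
    obtain ⟨i, hi, -⟩ := exists_of_fromLast_ne_one (n := n) (j := 0) (fun h1 => by
      rw [h1, Nat.gcd_one_left] at h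
      omega)
    have hζi : ζ ^ n i = 1 := by rw [hi]; exact pow_eq_one_of_orderOf_eq_gcd hζ
    obtain ⟨χ, hχ, -⟩ := exists_character e i ζ hζi
    obtain ⟨g, hg⟩ := exists_generator e i
    have hχg := hχ g hg
    -- The pair $\chi,\chi^2$ works because the four requirements are
    -- $\zeta^2,\zeta^4,\zeta,\zeta^3\ne1$, and `ζ` has order at least 5.
    refine exists_code_of_pair χ ((powMonoidHom 2).comp χ) ⟨g, ?_⟩ ⟨g, ?_⟩ ⟨g, ?_⟩ ⟨g, ?_⟩
    · rw [hχg, ← sq]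
      exact hlt two_ne_zero (by omega)
    · rw [MonoidHom.comp_apply, powMonoidHom_apply, hχg, ← pow_add]
      exact hlt (by omega) (by omega)
    · rw [MonoidHom.comp_apply, powMonoidHom_apply, hχg, sq]
      intro h1
      rw [left_eq_mul] at h1
      rw [h1, orderOf_one] at hζ
      omega
    · rw [MonoidHom.comp_apply, powMonoidHom_apply, hχg, ← pow_succ']
      exact hlt (by omega) (by omega)
  · obtain ⟨ζ, hζ⟩ := exists_unit_orderOf (K := F) (Nat.gcd_dvd_right (fromLast n 0) _)
    obtain ⟨ω, hω⟩ := exists_unit_orderOf (K := F) (Nat.gcd_dvd_right (fromLast n 1) _)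
    obtain ⟨i, hi, hir⟩ := exists_of_fromLast_ne_one (n := n) (j := 0) (fun h1 => by
      rw [h1, Nat.gcd_one_left] at h3
      omega)
    obtain ⟨j, hj, hjr⟩ := exists_of_fromLast_ne_one (n := n) (j := 1) (fun h1 => by
      rw [h1, Nat.gcd_one_left] at h2
      omega)
    have hij : i ≠ j := by
      rintro rfl
      omega
    have hζi : ζ ^ n i = 1 := by rw [hi]; exact pow_eq_one_of_orderOf_eq_gcd hζ
    have hωj : ω ^ n j = 1 := by rw [hj]; exact pow_eq_one_of_orderOf_eq_gcd hω
    obtain ⟨χ, hχ, -⟩ := exists_character e i ζ hζi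
    obtain ⟨θ, hθ, hθ'⟩ := exists_character e j ω hωj
    obtain ⟨g, hg⟩ := exists_generator e i
    obtain ⟨g', hg'⟩ := exists_generator e j
    have hχg := hχ g hg
    have hθg := hθ' i hij g hg
    have hθg' := hθ g' hg'
    have hζ2 : ζ * ζ ≠ 1 := by
      rw [← sq]
      exact hlt two_ne_zero (by omega)
    -- At `g` both characters equal `ζ` with $\zeta^2\ne1$, which rules out inverses; `g'` separates
    -- them, since $\theta(g')=\omega\ne1$.
    refine exists_code_of_pair χ (χ * θ) ⟨g, ?_⟩ ⟨g, ?_⟩ ⟨g', ?_⟩ ⟨g, ?_⟩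
    · rwa [hχg]
    · rwa [MonoidHom.mul_apply, hχg, hθg, mul_one]
    · rw [MonoidHom.mul_apply, hθg']
      intro h1
      rw [left_eq_mul] at h1
      rw [h1, orderOf_one] at hω
      omega
    · rwa [MonoidHom.mul_apply, hχg, hθg, mul_one]
  · obtain ⟨p, hp⟩ := CharP.exists F
    have : Fact p.Prime := ⟨CharP.char_is_prime F p⟩
    let K := FiniteField.Extension F p 2
    have hK : Nat.card K = Nat.card F ^ 2 := FiniteField.natCard_extension F p 2
    obtain ⟨ζ, hζ⟩ := exists_unit_orderOf (K := K) (Nat.gcd_dvd_right (fromLast n 0) _)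
    obtain ⟨i, hi, -⟩ := exists_of_fromLast_ne_one (n := n) (j := 0) (fun h3 => by
      rw [h3, Nat.gcd_one_left, Nat.gcd_one_left] at h1
      omega)
    have hζi : ζ ^ n i = 1 := by rw [hi]; exact pow_eq_one_of_orderOf_eq_gcd hζ
    obtain ⟨χ, hχ, -⟩ := exists_character e i ζ hζi
    obtain ⟨g, hg⟩ := exists_generator e i
    have hχg := hχ g hg
    -- If $\zeta^m=1$, the order $\gcd(n_r,q^2-1)$ of `ζ` would divide $\gcd(n_r,m)$, which is
    -- smaller. It is applied to $m=q-1$ and $m=q+1$.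
    have hne : ∀ m, 0 < m →
        Nat.gcd (fromLast n 0) m < Nat.gcd (fromLast n 0) (Nat.card F ^ 2 - 1) →
        χ g ^ m ≠ 1 := fun m hm hlt h3 => by
      rw [hχg, ← orderOf_dvd_iff_pow_eq_one, hζ, hK] at h3
      exact absurd (Nat.le_of_dvd (Nat.gcd_pos_of_pos_right _ hm)
        (Nat.dvd_gcd (Nat.gcd_dvd_left _ _) h3)) (not_le.2 hlt)
    have hq1 : 1 < Nat.card F := Finite.one_lt_card
    exact exists_code_of_quadratic (FiniteField.finrank_extension F p 2) χ
      ⟨g, hne _ (by omega) h1⟩ ⟨g, hne _ (by omega) h2⟩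

end Main

end GroupCode

/-- A group code in `F[G]` is a two-sided ideal `C` of the group algebra. -/
theorem theorem4p1 {F G : Type*} [Field F] [Finite F] [Group G] [Fintype G]
    (q : ℕ) (hq : Nat.card F = q) (hcop : Nat.Coprime (Nat.card G) q)
    (r : ℕ) (n : Fin r → ℕ) (hn : ∀ i, 1 < n i) (hdvd : ∀ i j, i ≤ j → n i ∣ n j)
    (e : Additive (Abelianization G) ≃+ (∀ i, ZMod (n i))) :
    (∃ C : Ideal (MonoidAlgebra F G), C.IsTwoSided ∧
        Module.finrank F (GroupCode.hull (C.restrictScalars F)) = 2) ↔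
      (5 ≤ Nat.gcd (GroupCode.fromLast n 0) (q - 1) ∨
      (3 ≤ Nat.gcd (GroupCode.fromLast n 0) (q - 1) ∧
        Nat.gcd (GroupCode.fromLast n 0) (q - 1) ≤ 4 ∧
        2 ≤ Nat.gcd (GroupCode.fromLast n 1) (q - 1)) ∨
      (Nat.gcd (GroupCode.fromLast n 0) (q - 1) < Nat.gcd (GroupCode.fromLast n 0) (q ^ 2 - 1) ∧
        Nat.gcd (GroupCode.fromLast n 0) (q + 1) <
          Nat.gcd (GroupCode.fromLast n 0) (q ^ 2 - 1))) := by
  subst hq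
  constructor
  · rintro ⟨C, hC, hdim⟩
    exact GroupCode.gcd_of_exists_code hcop e hdvd C hdim
  · exact GroupCode.exists_code_of_gcd e
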